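/- **Conventions.** A groupoid $G$ is a small category in which every arrow is invertible; we write $G$ also for its set of arrows, and $G^{(0)}\subset G$ for its set of objects, identified with the identity arrows. A topological groupoid is a groupoid whose arrow set carries a locally compact Hausdorff topology for which inversion and the partial multiplication (on the set $G^{(2)}\subset G\times G$ of composable pairs) are continuous; $G^{(0)}$ and $G^{(2)}$ carry the subspace topologies. It is $\sigma$-compact if its arrow space is. A cover $\mathcal U$ of a set refines a cover $\mathcal V$ if each element of $\mathcal U$ is contained in an element of $\mathcal V$; $\mathcal U$ star refines $\mathcal V$ if for each $U\in\mathcal U$ the union of all elements of $\mathcal U$ that meet $U$ is contained in an element of $\mathcal V$. A normal sequence of covers is a sequence $(\mathcal U_n)_{n\ge 0}$ of covers such that $\mathcal U_{n+1}$ star refines $\mathcal U_n$ for all $n\ge 0$. A normal sequence $\mathcal W_n=(\mathcal W_n^0,\mathcal W_n^1)$ of open covers of a topological groupoid $G$ consists of a normal sequence $(\mathcal W^0_n)$ of open covers of $G^{(0)}$ and a normal sequence $(\mathcal W^1_n)$ of open covers of the arrow space $G$. A map of topological spaces is called proper if preimages of closed compact sets are compact (when the target is Hausdorff: if preimages of compact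 sets are compact). The metric quotient of a pseudo-metric space $(X,d)$ is the quotient of $X$ by the relation $d(x,y)=0$, with the metric induced by $d$. **Theorem.** Let $G$ be a $\sigma$-compact topological groupoid whose source and target maps $G\to G^{(0)}$ are open, and let $(\mathcal W_n)_{n\ge 0}$ be any normal sequence of open covers of $G$. Then there is a pseudo-metric $d$ on (the arrow space of) $G$ whose metric quotient $G_\alpha$ carries a groupoid structure such that: 1. $G_\alpha$, with its metric topology, is a second countable, locally compact, Hausdorff topological groupoid, and the quotient map $G\to G_\alpha$ is a morphism of groupoids (in particular $G_\alpha^{(0)}$ is the image of $G^{(0)}$); 2. both maps in the chain $G\xrightarrow{\ \mathrm{id}_G\ }(G,d)\xrightarrow{\ p_\alpha\ }G_\alpha$ are continuous and proper; 3. for every $n\ge 0$, the preimage in $G$ of each open ball of radius $2^{-n}$ of $G_\alpha$ is contained in an element of $\mathcal W_n^1$, and the preimage in $G^{(0)}$ of each open ball of radius $2^{-n}$ of $G_\alpha^{(0)}$ is contained in an element of $\mathcal W_n^0$. -/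

import Mathlib

universe u v

/-- A groupoid (small category with all arrows invertible) given by its set of arrows `G`: the
objects are identified with the identity arrows, so that `src` and `tgt` take values in `G`, and
`mul g h` (first `h`, then `g`) is defined exactly when `src g = tgt h`. -/
structure GroupoidStructure (G : Type u) where
  src : G → G
  tgt : G → G
  mul : (g h : G) → src g = tgt h → G
  inv : G → G
  src_src : ∀ g, src (src g) = src g
  tgt_src : ∀ g, tgt (src g) = src g
  src_tgt : ∀ g, src (tgt g) = tgt g
  tgt_tgt : ∀ g, tgt (tgt g) = tgt g
  src_mul : ∀ g h (w : src g = tgt h), src (mul g h w) = src h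
  tgt_mul : ∀ g h (w : src g = tgt h), tgt (mul g h w) = tgt g
  mul_assoc : ∀ g h k (w : src g = tgt h) (w' : src h = tgt k),
    mul (mul g h w) k ((src_mul g h w).trans w') =
      mul g (mul h k w') (w.trans (tgt_mul h k w').symm)
  mul_src : ∀ g, mul g (src g) (tgt_src g).symm = g
  tgt_mul_self : ∀ g, mul (tgt g) g (src_tgt g) = g
  src_inv : ∀ g, src (inv g) = tgt g
  tgt_inv : ∀ g, tgt (inv g) = src g
  inv_mul : ∀ g, mul (inv g) g (src_inv g) = src g
  mul_inv : ∀ g, mul g (inv g) (tgt_inv g).symm = tgt g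

namespace GroupoidStructure

variable {G : Type u} (S : GroupoidStructure G)

/-- The object space, as the set of identity arrows. -/
def units : Set G := {x | S.src x = x}

/-- The source map, as a map from arrows to objects. -/
def source (g : G) : S.units := ⟨S.src g, S.src_src g⟩

/-- The target map, as a map from arrows to objects. -/
def target (g : G) : S.units := ⟨S.tgt g, S.src_tgt g⟩

/-- The set of composable pairs. -/
def Composable : Set (G × G) := {p | S.src p.1 = S.tgt p.2}

/-- A topological groupoid: the arrow space is locally compact and Hausdorff, and inversion and
the partial multiplication are continuous. (The object space and the set of composable pairs
carry the subspace topologies.) -/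
structure IsTopological [TopologicalSpace G] : Prop where
  locallyCompact : LocallyCompactSpace G
  hausdorff : T2Space G
  continuous_inv : Continuous S.inv
  continuous_mul : Continuous fun p : S.Composable => S.mul p.1.1 p.1.2 p.2

end GroupoidStructure

/-- Groupoid morphisms (functors), as maps between the arrow sets. -/
structure IsGroupoidMorphism {G : Type u} {H : Type v} (S : GroupoidStructure G)
    (T : GroupoidStructure H) (f : G → H) : Prop where
  map_src : ∀ g, T.src (f g) = f (S.src g)
  map_tgt : ∀ g, T.tgt (f g) = f (S.tgt g)
  map_mul : ∀ g h (w : S.src g = S.tgt h),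
    f (S.mul g h w) =
      T.mul (f g) (f h) ((map_src g).trans ((congrArg f w).trans (map_tgt h).symm))

section Covers

variable {X : Type u}

/-- `𝒰` is a cover of `X`. -/
def IsCover (𝒰 : Set (Set X)) : Prop := ⋃₀ 𝒰 = Set.univ

/-- Each element of `𝒰` is contained in some element of `𝒱`. -/
def Refines (𝒰 𝒱 : Set (Set X)) : Prop := ∀ U ∈ 𝒰, ∃ V ∈ 𝒱, U ⊆ V

/-- The star of a set `A` against `𝒰`: the union of the elements of `𝒰` that meet `A`. -/
def starOf (A : Set X) (𝒰 : Set (Set X)) : Set X := ⋃₀ {U ∈ 𝒰 | (U ∩ A).Nonempty}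

/-- `𝒰` star refines `𝒱`. -/
def StarRefines (𝒰 𝒱 : Set (Set X)) : Prop := Refines ((fun U => starOf U 𝒰) '' 𝒰) 𝒱

/-- A normal sequence of open covers of `X`. -/
structure IsNormalOpenSequence [TopologicalSpace X] (𝒲 : ℕ → Set (Set X)) : Prop where
  isOpen : ∀ n, ∀ U ∈ 𝒲 n, IsOpen U
  isCover : ∀ n, IsCover (𝒲 n)
  starRefines : ∀ n, StarRefines (𝒲 (n + 1)) (𝒲 n)

end Covers

/-- The set `X` with the topology, uniformity and distance of the pseudo-metric `d`, regardless of
any topology that `X` itself carries. -/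
def WithPseudoMetric {X : Type u} (_ : PseudoMetricSpace X) : Type u := X

instance {X : Type u} (d : PseudoMetricSpace X) : PseudoMetricSpace (WithPseudoMetric d) := d

/-- The identity map `X → (X, d)`. -/
def toPseudoMetric {X : Type u} (d : PseudoMetricSpace X) : X → WithPseudoMetric d := fun x => x

/-- The metric quotient of `(X, d)`: points at distance `0` are identified, and it carries the
metric induced by `d`. -/
abbrev MetricQuotient {X : Type u} (d : PseudoMetricSpace X) : Type u :=
  SeparationQuotient (WithPseudoMetric d)

/-- The quotient map `(X, d) → MetricQuotient d`. -/
def metricQuotientMap {X : Type u} (d : PseudoMetricSpace X) :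
    WithPseudoMetric d → MetricQuotient d := SeparationQuotient.mk

/-- The composite `X → (X, d) → MetricQuotient d`. -/
def toMetricQuotient {X : Type u} (d : PseudoMetricSpace X) (x : X) : MetricQuotient d :=
  metricQuotientMap d (toPseudoMetric d x)

/-- Proper maps: preimages of closed compact sets are compact. For a Hausdorff target, where compact
sets are closed, this says that preimages of compact sets are compact. In a pseudo-metric space
compact sets need not be closed (every subset of a class of points at mutual distance `0` is
compact), and the preimage of a non-closed compact set under the identity map to such a space
cannot be expected to be compact. -/
def IsProper {X : Type u} {Y : Type v} [TopologicalSpace X] [TopologicalSpace Y]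
    (f : X → Y) : Prop :=
  ∀ K : Set Y, IsClosed K → IsCompact K → IsCompact (f ⁻¹' K)

/-! If `δ` is a continuous pseudo-metric on `G` with compact balls, the map to its metric quotient
is proper. The groupoid structure passes to the quotient once the relation `δ = 0` respects the
operations and allows lifting of arrows along the source (`Descends`); properness then makes the
induced operations continuous. So the task is to find such a `δ` dominating pseudo-metrics
subordinate to the two normal sequences.

Start from `ρ`, the sum of these pseudo-metrics and `|φ g - φ h|`, where `φ` has compact sublevel
sets. A jointly continuous family of functions with `σ`-compact locally compact parameter space is
encoded by one pseudo-metric (`exists_isContinuousPseudoMetric_of_family`). Encoding the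
`ρ`-distances to products and to source fibres gives `σ ≥ ρ` such that `σ = 0` controls the
operations up to `ρ = 0` (`exists_pseudoMetric_controlling`). Iterating this and encoding all stages
in one `δ` closes the loop: `δ = 0` means that every stage vanishes, and lifts survive the limit by
compactness (`exists_pseudoMetric_compatible`). -/

open Set Filter Topology Function
open scoped NNReal

/-! ### Continuous pseudo-metrics and exhaustion functions -/

/-- A pseudo-metric on a topological space that is continuous for the given topology. -/
structure IsContinuousPseudoMetric {X : Type u} [TopologicalSpace X] (ρ : X → X → ℝ) : Prop where
  self : ∀ x, ρ x x = 0
  comm : ∀ x y, ρ x y = ρ y x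
  triangle : ∀ x y z, ρ x z ≤ ρ x y + ρ y z
  continuous : Continuous fun p : X × X => ρ p.1 p.2

namespace IsContinuousPseudoMetric

variable {X : Type u} {Y : Type v} [TopologicalSpace X] [TopologicalSpace Y] {ρ σ : X → X → ℝ}

theorem nonneg (hρ : IsContinuousPseudoMetric ρ) (x y : X) : 0 ≤ ρ x y := by
  have := hρ.triangle x y x
  rw [hρ.self, hρ.comm y x] at this
  linarith

theorem continuous_right (hρ : IsContinuousPseudoMetric ρ) (x : X) : Continuous (ρ x) :=
  hρ.continuous.comp (Continuous.prodMk_right x)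

theorem add (hρ : IsContinuousPseudoMetric ρ) (hσ : IsContinuousPseudoMetric σ) :
    IsContinuousPseudoMetric fun x y => ρ x y + σ x y where
  self x := by rw [hρ.self, hσ.self, add_zero]
  comm x y := by rw [hρ.comm, hσ.comm]
  triangle x y z := by linarith [hρ.triangle x y z, hσ.triangle x y z]
  continuous := hρ.continuous.add hσ.continuous

theorem comp (hρ : IsContinuousPseudoMetric ρ) {f : Y → X} (hf : Continuous f) :
    IsContinuousPseudoMetric fun x y => ρ (f x) (f y) where
  self _ := hρ.self _
  comm _ _ := hρ.comm _ _
  triangle _ _ _ := hρ.triangle _ _ _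
  continuous := hρ.continuous.comp (hf.prodMap hf)

theorem of_dist {M : Type*} [PseudoMetricSpace M] {f : X → M} (hf : Continuous f) :
    IsContinuousPseudoMetric fun x y => dist (f x) (f y) where
  self _ := dist_self _
  comm _ _ := dist_comm _ _
  triangle _ _ _ := dist_triangle _ _ _
  continuous := (hf.comp continuous_fst).dist (hf.comp continuous_snd)

theorem eq_right_of_eq_zero (hρ : IsContinuousPseudoMetric ρ) {x y : X} (h : ρ x y = 0) (z : X) :
    ρ z x = ρ z y := by
  have h₁ := hρ.triangle z x y
  have h₂ := hρ.triangle z y x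
  rw [hρ.comm y x] at h₂
  linarith

theorem eq_zero_of_add (hρ : IsContinuousPseudoMetric ρ) (hσ : IsContinuousPseudoMetric σ)
    {x y x' y' : X} (h : ρ x y + σ x' y' = 0) : ρ x y = 0 ∧ σ x' y' = 0 :=
  (add_eq_zero_iff_of_nonneg (hρ.nonneg _ _) (hσ.nonneg _ _)).1 h

end IsContinuousPseudoMetric

/-- A jointly continuous family of functions on `X`, indexed by a locally compact `σ`-compact
space, is separated by a single continuous pseudo-metric. -/
theorem exists_isContinuousPseudoMetric_of_family {X Y : Type*} [TopologicalSpace X]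
    [TopologicalSpace Y] [LocallyCompactSpace Y] [SigmaCompactSpace Y] (F : Y → X → ℝ)
    (hF : Continuous fun p : X × Y => F p.2 p.1) :
    ∃ σ : X → X → ℝ, IsContinuousPseudoMetric σ ∧
      ∀ x x', σ x x' = 0 ↔ ∀ y, F y x = F y x' := by
  -- The compact-open topology on `C(Y, ℝ)` is metrizable under the assumptions on `Y`; its metric
  -- is pulled back along the curried family.
  let c : C(X, C(Y, ℝ)) := ContinuousMap.curry ⟨fun p : X × Y => F p.2 p.1, hF⟩
  let _ : MetricSpace C(Y, ℝ) := TopologicalSpace.metrizableSpaceMetric _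
  refine ⟨fun x x' => dist (c x) (c x'), .of_dist c.continuous, fun x x' => ?_⟩
  rw [dist_eq_zero, ContinuousMap.ext_iff]
  rfl

/-- A `σ`-compact locally compact Hausdorff space has a continuous function with relatively compact
sublevel sets. -/
theorem exists_continuous_isCompact_sublevel (X : Type*) [TopologicalSpace X]
    [LocallyCompactSpace X] [T2Space X] [SigmaCompactSpace X] :
    ∃ φ : C(X, ℝ), ∀ r, IsCompact {x | φ x ≤ r} := by
  let K : CompactExhaustion X := default
  -- A partition of unity patches local constants into a continuous `φ ≥ K.find`. Near `x` the
  -- constant `K.find x + 1` works, since the next compact set is a neighbourhood of `x`.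
  obtain ⟨φ, hφ⟩ := exists_continuous_forall_mem_convex_of_local_const
    (t := fun x => Ici (K.find x : ℝ)) (fun x => convex_Ici _) fun x =>
      ⟨(K.find x + 1 : ℕ), by
        filter_upwards [isOpen_interior.mem_nhds (K.subset_interior_succ _ (K.mem_find x))]
          with y hy
        exact Nat.cast_le (α := ℝ).2 (K.mem_iff_find_le.1 (interior_subset hy))⟩
  refine ⟨φ, fun r => (K.isCompact ⌊r⌋₊).of_isClosed_subset
    (isClosed_le φ.continuous continuous_const) fun x hx => K.mem_iff_find_le.2 ?_⟩
  exact Nat.le_floor ((hφ x).trans hx)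

/-! ### Metrization of normal sequences of covers -/

section Metrization

variable {X : Type u}

theorem subset_starOf (U : Set X) {𝒰 : Set (Set X)} (hU : U ∈ 𝒰) : U ⊆ starOf U 𝒰 :=
  fun x hx => ⟨U, ⟨hU, x, hx, hx⟩, hx⟩

theorem StarRefines.refines {𝒰 𝒱 : Set (Set X)} (h : StarRefines 𝒰 𝒱) : Refines 𝒰 𝒱 := by
  intro U hU
  obtain ⟨V, hV, hUV⟩ := h _ ⟨U, hU, rfl⟩
  exact ⟨V, hV, (subset_starOf U hU).trans hUV⟩

/-- Two points are `𝒰`-close if they lie in a common element of `𝒰`. -/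
def CoverClose (𝒰 : Set (Set X)) (x y : X) : Prop := ∃ U ∈ 𝒰, x ∈ U ∧ y ∈ U

theorem CoverClose.symm {𝒰 : Set (Set X)} {x y : X} (h : CoverClose 𝒰 x y) : CoverClose 𝒰 y x :=
  let ⟨U, hU, hx, hy⟩ := h
  ⟨U, hU, hy, hx⟩

/-- The element containing `b` and `c` meets both others, so its star contains `a` and `d`. -/
theorem StarRefines.coverClose_of_three {𝒰 𝒱 : Set (Set X)} (h : StarRefines 𝒰 𝒱) {a b c d : X}
    (hab : CoverClose 𝒰 a b) (hbc : CoverClose 𝒰 b c) (hcd : CoverClose 𝒰 c d) :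
    CoverClose 𝒱 a d := by
  obtain ⟨U₁, hU₁, ha, hb⟩ := hab
  obtain ⟨U₂, hU₂, hb', hc⟩ := hbc
  obtain ⟨U₃, hU₃, hc', hd⟩ := hcd
  obtain ⟨V, hV, hUV⟩ := h _ ⟨U₂, hU₂, rfl⟩
  exact ⟨V, hV, hUV ⟨U₁, ⟨hU₁, b, hb, hb'⟩, ha⟩, hUV ⟨U₃, ⟨hU₃, c, hc', hc⟩, hd⟩⟩

variable [TopologicalSpace X] {𝒲 : ℕ → Set (Set X)}

theorem IsNormalOpenSequence.exists_mem (h𝒲 : IsNormalOpenSequence 𝒲) (n : ℕ) (x : X) :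
    ∃ U ∈ 𝒲 n, x ∈ U :=
  mem_sUnion.1 ((h𝒲.isCover n).symm ▸ mem_univ x)

theorem IsNormalOpenSequence.coverClose_antitone (h𝒲 : IsNormalOpenSequence 𝒲) {x y : X} {m n : ℕ}
    (hmn : m ≤ n) (h : CoverClose (𝒲 n) x y) : CoverClose (𝒲 m) x y := by
  induction n, hmn using Nat.le_induction with
  | base => exact h
  | succ n _ ih =>
    obtain ⟨U, hU, hx, hy⟩ := h
    obtain ⟨V, hV, hUV⟩ := (h𝒲.starRefines n).refines U hU
    exact ih ⟨V, hV, hUV hx, hUV hy⟩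

open Classical in
/-- A normal sequence of open covers is subordinate to a continuous pseudo-metric. -/
theorem IsNormalOpenSequence.exists_isContinuousPseudoMetric (h𝒲 : IsNormalOpenSequence 𝒲) :
    ∃ ρ : X → X → ℝ, IsContinuousPseudoMetric ρ ∧
      ∀ n x, ∃ V ∈ 𝒲 n, {y | ρ x y < (1 / 2 : ℝ) ^ n} ⊆ V := by
  -- Only a weak triangle inequality for chains of three steps holds for this `δ`; the chain
  -- construction then gives a pseudo-metric `m` with `m ≤ δ ≤ 2m`.
  let δ : X → X → ℝ≥0 := fun x y =>
    if h : ∃ n, ¬ CoverClose (𝒲 n) x y then (1 / 2) ^ Nat.find h else 0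
  have hδ_self : ∀ x, δ x x = 0 := fun x => dif_neg <| by
    rintro ⟨n, hn⟩
    obtain ⟨U, hU, hx⟩ := h𝒲.exists_mem n x
    exact hn ⟨U, hU, hx, hx⟩
  have hδ_comm : ∀ x y, δ x y = δ y x := fun x y => by
    have hn : ∀ n, CoverClose (𝒲 n) x y ↔ CoverClose (𝒲 n) y x := fun _ => ⟨.symm, .symm⟩
    simp only [δ, hn]
  have hr : (1 / 2 : ℝ≥0) ∈ Ioo (0 : ℝ≥0) 1 := ⟨by positivity, NNReal.half_lt_self one_ne_zero⟩
  have hδ_lt : ∀ n x y, δ x y < (1 / 2) ^ n ↔ CoverClose (𝒲 n) x y := by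
    intro n x y
    by_cases h : ∃ n, ¬ CoverClose (𝒲 n) x y
    · simp only [δ, dif_pos h]
      rw [pow_lt_pow_iff_right_of_lt_one₀ hr.1 hr.2]
      refine ⟨fun hn => not_not.1 (Nat.find_min h hn), fun hn => ?_⟩
      by_contra hle
      exact Nat.find_spec h (h𝒲.coverClose_antitone (not_lt.1 hle) hn)
    · simp only [δ, dif_neg h, pow_pos hr.1 n, true_iff]
      exact not_not.1 fun hn => h ⟨n, hn⟩
  have hδ_three : ∀ x₁ x₂ x₃ x₄, δ x₁ x₄ ≤ 2 * max (δ x₁ x₂) (max (δ x₂ x₃) (δ x₃ x₄)) := by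
    intro x₁ x₂ x₃ x₄
    by_cases h : ∃ n, ¬ CoverClose (𝒲 n) x₁ x₄
    · by_contra! hlt
      have hx : δ x₁ x₄ = (1 / 2) ^ Nat.find h := dif_pos h
      have hm : max (δ x₁ x₂) (max (δ x₂ x₃) (δ x₃ x₄)) < (1 / 2) ^ (Nat.find h + 1) := by
        rw [pow_succ, ← hx, mul_one_div, lt_div_iff₀ (two_pos : (0 : ℝ≥0) < 2), mul_comm]
        exact hlt
      rw [max_lt_iff, max_lt_iff, hδ_lt, hδ_lt, hδ_lt] at hm
      exact Nat.find_spec h ((h𝒲.starRefines _).coverClose_of_three hm.1 hm.2.1 hm.2.2)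
    · simp only [δ, dif_neg h, zero_le]
  let m : PseudoMetricSpace X := PseudoMetricSpace.ofPreNNDist δ hδ_self hδ_comm
  have hle : ∀ x y, m.dist x y ≤ δ x y := PseudoMetricSpace.dist_ofPreNNDist_le δ hδ_self hδ_comm
  have hge : ∀ x y, (δ x y : ℝ) ≤ 2 * m.dist x y :=
    PseudoMetricSpace.le_two_mul_dist_ofPreNNDist δ hδ_self hδ_comm hδ_three
  have hcont : Continuous (toPseudoMetric m) := by
    refine continuous_iff_continuousAt.2 fun x => Metric.tendsto_nhds.2 fun ε hε => ?_
    obtain ⟨n, hn⟩ := exists_pow_lt_of_lt_one hε (one_half_lt_one : (1 / 2 : ℝ) < 1)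
    obtain ⟨U, hU, hx⟩ := h𝒲.exists_mem n x
    filter_upwards [(h𝒲.isOpen n U hU).mem_nhds hx] with y hy
    have h : (δ y x : ℝ) < (1 / 2) ^ n := by exact_mod_cast (hδ_lt n y x).2 ⟨U, hU, hy, hx⟩
    exact ((hle y x).trans_lt h).trans hn
  have hm := IsContinuousPseudoMetric.of_dist hcont
  -- Take `4m`: one factor 2 pays for `δ ≤ 2m`, the other for passing to level `n + 1`, where the
  -- star of one element fits into an element of level `n`.
  refine ⟨_, (hm.add hm).add (hm.add hm), fun n x => ?_⟩
  obtain ⟨U, hU, hx⟩ := h𝒲.exists_mem (n + 1) x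
  obtain ⟨V, hV, hUV⟩ := h𝒲.starRefines n _ ⟨U, hU, rfl⟩
  refine ⟨V, hV, fun y hy => hUV ?_⟩
  have hy' : m.dist x y + m.dist x y + (m.dist x y + m.dist x y) < (1 / 2 : ℝ) ^ n := hy
  have h : (δ x y : ℝ) < (1 / 2) ^ (n + 1) := by
    rw [pow_succ]
    linarith [hge x y]
  obtain ⟨W, hW, hxW, hyW⟩ := (hδ_lt (n + 1) x y).1 (by exact_mod_cast h)
  exact ⟨W, ⟨hW, x, hxW, hx⟩, hyW⟩

end Metrization

/-! ### Descent of a groupoid structure along a surjection -/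

namespace GroupoidStructure

variable {G : Type u} {H : Type v}

/-- The compatibility conditions under which a surjection `p` from the arrows of a groupoid carries
the groupoid structure over to its target. -/
structure Descends (S : GroupoidStructure G) (p : G → H) : Prop where
  surjective : Surjective p
  src : ∀ {g g'}, p g = p g' → p (S.src g) = p (S.src g')
  tgt : ∀ {g g'}, p g = p g' → p (S.tgt g) = p (S.tgt g')
  inv : ∀ {g g'}, p g = p g' → p (S.inv g) = p (S.inv g')
  mul : ∀ {g g' h h'} (w : S.src g = S.tgt h) (w' : S.src g' = S.tgt h'), p g = p g' → p h = p h' →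
    p (S.mul g h w) = p (S.mul g' h' w')
  -- This makes every composable pair of `H` the image of a composable pair of `G`: the first arrow
  -- is replaced within its class to fit the second.
  lift : ∀ g y, S.src y = y → p (S.src g) = p y → ∃ g', S.src g' = y ∧ p g' = p g

namespace Descends

variable {S : GroupoidStructure G} {p : G → H}

/-- The map on `H` induced by a self-map of `G` that is compatible with `p`. -/
noncomputable def descend (hp : S.Descends p) (f : G → G) (a : H) : H :=
  p (f (surjInv hp.surjective a))

theorem descend_apply (hp : S.Descends p) {f : G → G}
    (hf : ∀ {g g'}, p g = p g' → p (f g) = p (f g')) (g : G) : hp.descend f (p g) = p (f g) :=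
  hf (surjInv_eq hp.surjective (p g))

theorem descend_src (hp : S.Descends p) (g : G) : hp.descend S.src (p g) = p (S.src g) :=
  hp.descend_apply hp.src g

theorem descend_tgt (hp : S.Descends p) (g : G) : hp.descend S.tgt (p g) = p (S.tgt g) :=
  hp.descend_apply hp.tgt g

theorem descend_inv (hp : S.Descends p) (g : G) : hp.descend S.inv (p g) = p (S.inv g) :=
  hp.descend_apply hp.inv g

theorem descend_composable (hp : S.Descends p) {g h : G} (w : S.src g = S.tgt h) :
    hp.descend S.src (p g) = hp.descend S.tgt (p h) := by
  rw [hp.descend_src, hp.descend_tgt, w]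

theorem exists_composable_left (hp : S.Descends p) {a : H} {h : G}
    (w : hp.descend S.src a = hp.descend S.tgt (p h)) : ∃ g, S.src g = S.tgt h ∧ p g = a := by
  obtain ⟨g, rfl⟩ := hp.surjective a
  rw [hp.descend_src, hp.descend_tgt] at w
  exact hp.lift g (S.tgt h) (S.src_tgt h) w

theorem exists_composable (hp : S.Descends p) {a b : H}
    (w : hp.descend S.src a = hp.descend S.tgt b) :
    ∃ q : G × G, S.src q.1 = S.tgt q.2 ∧ p q.1 = a ∧ p q.2 = b := by
  obtain ⟨h, rfl⟩ := hp.surjective b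
  obtain ⟨g, hg, hga⟩ := hp.exists_composable_left w
  exact ⟨(g, h), hg, hga, rfl⟩

/-- The multiplication induced on `H`. -/
noncomputable def descendMul (hp : S.Descends p) (a b : H)
    (w : hp.descend S.src a = hp.descend S.tgt b) : H :=
  p (S.mul _ _ (hp.exists_composable w).choose_spec.1)

theorem descendMul_eq (hp : S.Descends p) {a b : H} (w : hp.descend S.src a = hp.descend S.tgt b)
    {g h : G} (w' : S.src g = S.tgt h) (hg : p g = a) (hh : p h = b) :
    hp.descendMul a b w = p (S.mul g h w') :=
  have hq := (hp.exists_composable w).choose_spec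
  hp.mul _ _ (hq.2.1.trans hg.symm) (hq.2.2.trans hh.symm)

/-- The groupoid structure carried over along `p`. -/
noncomputable def quotient (hp : S.Descends p) : GroupoidStructure H where
  src := hp.descend S.src
  tgt := hp.descend S.tgt
  mul := hp.descendMul
  inv := hp.descend S.inv
  src_src a := by
    obtain ⟨g, rfl⟩ := hp.surjective a
    rw [hp.descend_src, hp.descend_src, S.src_src]
  tgt_src a := by
    obtain ⟨g, rfl⟩ := hp.surjective a
    rw [hp.descend_src, hp.descend_tgt, S.tgt_src]
  src_tgt a := by
    obtain ⟨g, rfl⟩ := hp.surjective a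
    rw [hp.descend_tgt, hp.descend_src, S.src_tgt]
  tgt_tgt a := by
    obtain ⟨g, rfl⟩ := hp.surjective a
    rw [hp.descend_tgt, hp.descend_tgt, S.tgt_tgt]
  src_mul a b w := by
    obtain ⟨⟨g, h⟩, w', rfl, rfl⟩ := hp.exists_composable w
    rw [hp.descendMul_eq w w' rfl rfl, hp.descend_src, hp.descend_src, S.src_mul]
  tgt_mul a b w := by
    obtain ⟨⟨g, h⟩, w', rfl, rfl⟩ := hp.exists_composable w
    rw [hp.descendMul_eq w w' rfl rfl, hp.descend_tgt, hp.descend_tgt, S.tgt_mul]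
  mul_assoc a b c w w' := by
    -- Lift the last two arrows first; the first one can then be lifted to end up with a composable
    -- triple.
    obtain ⟨⟨h, k⟩, v', rfl, rfl⟩ := hp.exists_composable w'
    obtain ⟨g, v, rfl⟩ := hp.exists_composable_left w
    rw [hp.descendMul_eq _ ((S.src_mul g h v).trans v') (hp.descendMul_eq w v rfl rfl).symm rfl,
      hp.descendMul_eq _ (v.trans (S.tgt_mul h k v').symm) rfl
        (hp.descendMul_eq w' v' rfl rfl).symm, S.mul_assoc]
  mul_src a := by
    obtain ⟨g, rfl⟩ := hp.surjective a
    rw [hp.descendMul_eq _ (S.tgt_src g).symm rfl (hp.descend_src g).symm, S.mul_src]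
  tgt_mul_self a := by
    obtain ⟨g, rfl⟩ := hp.surjective a
    rw [hp.descendMul_eq _ (S.src_tgt g) (hp.descend_tgt g).symm rfl, S.tgt_mul_self]
  src_inv a := by
    obtain ⟨g, rfl⟩ := hp.surjective a
    rw [hp.descend_inv, hp.descend_src, hp.descend_tgt, S.src_inv]
  tgt_inv a := by
    obtain ⟨g, rfl⟩ := hp.surjective a
    rw [hp.descend_inv, hp.descend_src, hp.descend_tgt, S.tgt_inv]
  inv_mul a := by
    obtain ⟨g, rfl⟩ := hp.surjective a
    rw [hp.descendMul_eq _ (S.src_inv g) (hp.descend_inv g).symm rfl, S.inv_mul, hp.descend_src]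
  mul_inv a := by
    obtain ⟨g, rfl⟩ := hp.surjective a
    rw [hp.descendMul_eq _ (S.tgt_inv g).symm rfl (hp.descend_inv g).symm, S.mul_inv,
      hp.descend_tgt]

theorem isGroupoidMorphism (hp : S.Descends p) : IsGroupoidMorphism S hp.quotient p where
  map_src := hp.descend_src
  map_tgt := hp.descend_tgt
  map_mul _ _ w := (hp.descendMul_eq (hp.descend_composable w) w rfl rfl).symm

end Descends

/-! ### Continuity of the descended operations -/

section Topology

variable {S : GroupoidStructure G} [TopologicalSpace G]

theorem IsTopological.continuous_src (hS : S.IsTopological) : Continuous S.src := by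
  have h : Continuous fun g => (⟨(S.inv g, g), S.src_inv g⟩ : S.Composable) :=
    (hS.continuous_inv.prodMk continuous_id).subtype_mk _
  exact (hS.continuous_mul.comp h).congr S.inv_mul

theorem IsTopological.continuous_tgt (hS : S.IsTopological) : Continuous S.tgt := by
  have h : Continuous fun g => (⟨(g, S.inv g), (S.tgt_inv g).symm⟩ : S.Composable) :=
    (continuous_id.prodMk hS.continuous_inv).subtype_mk _
  exact (hS.continuous_mul.comp h).congr S.mul_inv

theorem IsTopological.continuous_source (hS : S.IsTopological) : Continuous S.source :=
  hS.continuous_src.subtype_mk _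

theorem IsTopological.isClosed_composable (hS : S.IsTopological) : IsClosed S.Composable :=
  have := hS.hausdorff
  isClosed_eq (hS.continuous_src.comp continuous_fst) (hS.continuous_tgt.comp continuous_snd)

/-- The image of a locally compact space under a proper surjection is locally compact. -/
theorem _root_.IsProperMap.locallyCompactSpace {X Y : Type*} [TopologicalSpace X]
    [TopologicalSpace Y] [T2Space Y] [LocallyCompactSpace X] {f : X → Y} (hf : IsProperMap f)
    (hs : Surjective f) : LocallyCompactSpace Y := by
  have : WeaklyLocallyCompactSpace Y := ⟨fun y => by
    obtain ⟨K, hK, hyK⟩ := exists_compact_superset (hf.isCompact_preimage isCompact_singleton)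
      (K := f ⁻¹' {y})
    refine ⟨f '' K, hK.image hf.continuous, ?_⟩
    have hopen : IsOpen (f '' (interior K)ᶜ)ᶜ :=
      (hf.isClosedMap _ isOpen_interior.isClosed_compl).isOpen_compl
    refine mem_of_superset (hopen.mem_nhds ?_) fun z hz => ?_
    · rintro ⟨x, hx, rfl⟩
      exact hx (hyK rfl)
    · obtain ⟨x, rfl⟩ := hs z
      exact ⟨x, interior_subset (not_not.1 fun hx => hz ⟨x, hx, rfl⟩), rfl⟩⟩
  infer_instance

/-- The groupoid structure carried over along a proper map is topological. -/
theorem Descends.isTopological_quotient [TopologicalSpace H] [T2Space H] {p : G → H}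
    (hp : S.Descends p) (hS : S.IsTopological) (hprop : IsProperMap p) :
    hp.quotient.IsTopological where
  locallyCompact := have := hS.locallyCompact; hprop.locallyCompactSpace hp.surjective
  hausdorff := inferInstance
  continuous_inv := by
    rw [(hprop.isClosedMap.isQuotientMap hprop.continuous hp.surjective).continuous_iff]
    exact (hprop.continuous.comp hS.continuous_inv).congr fun g => (hp.descend_inv g).symm
  continuous_mul := by
    let P : S.Composable → hp.quotient.Composable := fun q =>
      ⟨(p q.1.1, p q.1.2), hp.descend_composable q.2⟩
    have hPc : Continuous P :=
      ((hprop.continuous.prodMap hprop.continuous).comp continuous_subtype_val).subtype_mk _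
    have hPs : Surjective P := by
      rintro ⟨⟨a, b⟩, w⟩
      obtain ⟨⟨g, h⟩, w', rfl, rfl⟩ := hp.exists_composable w
      exact ⟨⟨(g, h), w'⟩, rfl⟩
    -- `P` restricts the closed map `p × p` to the closed set of composable pairs, which is the full
    -- preimage of its image.
    have hPcl : IsClosedMap P := by
      intro C hC
      have h := (hprop.prodMap hprop).isClosedMap _
        (hS.isClosed_composable.isClosedMap_subtype_val C hC)
      convert h.preimage continuous_subtype_val using 1
      ext ⟨⟨a, b⟩, w⟩
      constructor
      · rintro ⟨q, hq, hqe⟩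
        exact ⟨q.1, ⟨q, hq, rfl⟩, congrArg Subtype.val hqe⟩
      · rintro ⟨_, ⟨q, hq, rfl⟩, hqe⟩
        exact ⟨q, hq, Subtype.ext hqe⟩
    rw [(hPcl.isQuotientMap hPc hPs).continuous_iff]
    exact (hprop.continuous.comp hS.continuous_mul).congr fun q =>
      (hp.descendMul_eq (hp.descend_composable q.2) q.2 rfl rfl).symm

end Topology
end GroupoidStructure

/-! ### Pseudo-metrics controlling the operations -/

namespace GroupoidStructure

variable {G : Type u} {S : GroupoidStructure G} [TopologicalSpace G] {ρ : G → G → ℝ}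

/-- The multiplication is controlled by a continuous pseudo-metric on the arrow space. -/
theorem IsTopological.exists_pseudoMetric_mul (hS : S.IsTopological) [SigmaCompactSpace G]
    (hρ : IsContinuousPseudoMetric ρ) :
    ∃ σ : G → G → ℝ, IsContinuousPseudoMetric σ ∧ ∀ g g' h h' (w : S.src g = S.tgt h)
      (w' : S.src g' = S.tgt h'), σ g g' = 0 → σ h h' = 0 →
        ρ (S.mul g h w) (S.mul g' h' w') = 0 := by
  have := hS.hausdorff
  have := hS.locallyCompact
  have hcl : IsClosed {q : G × (G × G) | q.2 ∈ S.Composable} :=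
    hS.isClosed_composable.preimage continuous_snd
  have hmul : Continuous fun q : {q : G × (G × G) | q.2 ∈ S.Composable} =>
      S.mul q.1.2.1 q.1.2.2 q.2 :=
    hS.continuous_mul.comp
      ((continuous_snd.comp continuous_subtype_val).subtype_mk fun q => q.2)
  -- Tietze extension to all triples, so that the two factors can be varied independently.
  obtain ⟨F, hF⟩ := ContinuousMap.exists_restrict_eq hcl
    ⟨fun q => ρ q.1.1 (S.mul q.1.2.1 q.1.2.2 q.2),
      hρ.continuous.comp ((continuous_fst.comp continuous_subtype_val).prodMk hmul)⟩
  have hF' : ∀ y g h (w : S.src g = S.tgt h), F (y, g, h) = ρ y (S.mul g h w) := fun y g h w =>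
    DFunLike.congr_fun hF ⟨(y, g, h), w⟩
  obtain ⟨σ₁, hσ₁, h₁⟩ := exists_isContinuousPseudoMetric_of_family
    (fun (z : G × G) g => F (z.1, g, z.2)) (by fun_prop)
  obtain ⟨σ₂, hσ₂, h₂⟩ := exists_isContinuousPseudoMetric_of_family
    (fun (z : G × G) h => F (z.1, z.2, h)) (by fun_prop)
  refine ⟨_, hσ₁.add hσ₂, fun g g' h h' w w' hg hh => ?_⟩
  have hg := (h₁ g g').1 (hσ₁.eq_zero_of_add hσ₂ hg).1
  have hh := (h₂ h h').1 (hσ₁.eq_zero_of_add hσ₂ hh).2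
  -- Replace `h'` by `h`, then `g'` by `g`, testing against the point `gh`. The intermediate pair
  -- `(g', h)` need not be composable, hence the extension.
  rw [← hF' _ _ _ w', ← hh (_, g'), ← hg (_, h), hF' _ _ _ w, hρ.self]

/-- Lifting of arrows along the source map is controlled by a continuous pseudo-metric. -/
theorem IsTopological.exists_pseudoMetric_lift (hS : S.IsTopological) [SigmaCompactSpace G]
    (hsource : IsOpenMap S.source) (hρ : IsContinuousPseudoMetric ρ)
    (hcpt : ∀ g r, IsCompact {h | ρ g h ≤ r}) :
    ∃ σ : G → G → ℝ, IsContinuousPseudoMetric σ ∧ ∀ g y, S.src y = y → σ (S.src g) y = 0 →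
      ∃ g', S.src g' = y ∧ ρ g g' = 0 := by
  have := hS.hausdorff
  have := hS.locallyCompact
  let F : G → S.units → ℝ := fun g x => ⨅ h : {h // S.source h = x}, min 1 (ρ g h)
  have hne : ∀ x : S.units, Nonempty {h // S.source h = x} := fun x =>
    ⟨⟨x, Subtype.ext x.2⟩⟩
  have hbdd : ∀ g (x : S.units),
      BddBelow (range fun h : {h // S.source h = x} => min 1 (ρ g h)) := fun g x =>
    ⟨0, by rintro _ ⟨h, rfl⟩; exact le_min zero_le_one (hρ.nonneg _ _)⟩
  have hF_lt : ∀ g x c, F g x < c ↔ ∃ h, S.source h = x ∧ min 1 (ρ g h) < c := fun g x c => by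
    simp only [F, ciInf_lt_iff (hbdd g x), Subtype.exists, exists_prop]
  have hF_le : ∀ g x, F g x ≤ 1 := fun g x =>
    (ciInf_le (hbdd g x) (hne x).some).trans (min_le_left _ _)
  have hF_cont : ∀ g, Continuous (F g) := by
    intro g
    refine continuous_iff_lower_upperSemicontinuous.2 ⟨fun x c hc => ?_, fun x c hc => ?_⟩
    -- Lower semicontinuity comes from compact balls, whose source images are closed.
    · obtain ⟨c', hc', hc'x⟩ := exists_between hc
      have hclosed : IsClosed (S.source '' {h | ρ g h ≤ c'}) :=
        ((hcpt g c').image hS.continuous_source).isClosed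
      have hx : x ∉ S.source '' {h | ρ g h ≤ c'} := by
        rintro ⟨h, hh, rfl⟩
        exact hc'x.not_ge ((ciInf_le (hbdd g _) ⟨h, rfl⟩).trans ((min_le_right _ _).trans hh))
      filter_upwards [hclosed.isOpen_compl.mem_nhds hx] with y hy
      refine hc'.trans_le (le_ciInf fun h => le_min (hc'x.le.trans (hF_le g x)) ?_)
      exact le_of_not_ge fun hh => hy ⟨h, hh, h.2⟩
    -- Upper semicontinuity is where openness of the source map enters.
    · have hopen : IsOpen (S.source '' {h | min 1 (ρ g h) < c}) :=
        hsource _ (isOpen_lt (continuous_const.min (hρ.continuous_right g)) continuous_const)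
      obtain ⟨h, hh, hhc⟩ := (hF_lt g x c).1 hc
      filter_upwards [hopen.mem_nhds ⟨h, hhc, hh⟩] with y ⟨k, hk, hky⟩
      exact (hF_lt g y c).2 ⟨k, hky, hk⟩
  have hF_lip : ∀ g g' x, F g x ≤ F g' x + ρ g g' := by
    intro g g' x
    rw [← sub_le_iff_le_add]
    refine le_ciInf fun h => ?_
    rw [sub_le_iff_le_add]
    refine (ciInf_le (hbdd g x) h).trans ?_
    have h₀ := hρ.nonneg g g'
    have h₁ := hρ.triangle g g' h
    rcases le_total 1 (ρ g' h) with h₂ | h₂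
    · rw [min_eq_left h₂]
      linarith [min_le_left 1 (ρ g h)]
    · rw [min_eq_right h₂]
      linarith [min_le_right 1 (ρ g h)]
  have hF_joint : Continuous fun q : S.units × G => F q.2 q.1 := by
    refine continuous_iff_continuousAt.2 fun ⟨x, g⟩ => Metric.tendsto_nhds.2 fun ε hε => ?_
    have h₁ : ∀ᶠ y in 𝓝 x, |F g y - F g x| < ε / 2 :=
      Metric.tendsto_nhds.1 (hF_cont g).continuousAt (ε / 2) (half_pos hε)
    have h₂ : ∀ᶠ k in 𝓝 g, ρ g k < ε / 2 :=
      (hρ.continuous_right g).continuousAt.eventually_lt continuousAt_const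
        (by rw [hρ.self]; exact half_pos hε)
    filter_upwards [h₁.prod_nhds h₂] with ⟨y, k⟩ ⟨hy, hk⟩
    have h₃ := hF_lip g k y
    have h₄ := hF_lip k g y
    rw [hρ.comm k g] at h₄
    simp only at hy hk
    rw [abs_lt] at hy
    rw [Real.dist_eq, abs_lt]
    constructor <;> simp only <;> linarith
  obtain ⟨σ, hσ, hσF⟩ := exists_isContinuousPseudoMetric_of_family F hF_joint
  refine ⟨_, hσ.comp hS.continuous_source, fun g y hy hgy => ?_⟩
  have hgy := (hσF _ _).1 hgy g
  have hzero : F g (S.source (S.src g)) ≤ 0 :=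
    (ciInf_le (hbdd g (S.source (S.src g)))
      ⟨g, (Subtype.ext (S.src_src g).symm : S.source g = S.source (S.src g))⟩).trans
      ((min_le_right _ _).trans (hρ.self g).le)
  rw [hgy] at hzero
  have hsy : ∀ h, S.source h = S.source y ↔ S.src h = y := fun h => by
    rw [Subtype.ext_iff]; exact ⟨fun e => e.trans hy, fun e => e.trans hy.symm⟩
  have hcl : IsClosed {h | S.src h = y} := isClosed_eq hS.continuous_src continuous_const
  have hex : ∀ ε > 0, ε ≤ 1 → ∃ h, S.src h = y ∧ ρ g h < ε := fun ε hε hε' => by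
    obtain ⟨h, hh, hlt⟩ := (hF_lt g _ ε).1 (hzero.trans_lt hε)
    refine ⟨h, (hsy h).1 hh, (min_lt_iff.1 hlt).resolve_left hε'.not_gt⟩
  obtain ⟨h₀, hh₀, hlt₀⟩ := hex 1 one_pos le_rfl
  -- The infimum over the fibre is zero; compactness of the unit ball makes it attained.
  obtain ⟨k, ⟨hk, hky⟩, hmin⟩ := ((hcpt g 1).inter_right hcl).exists_isMinOn
    ⟨h₀, hlt₀.le, hh₀⟩ (hρ.continuous_right g).continuousOn
  refine ⟨k, hky, le_antisymm (le_of_not_gt fun hpos => ?_) (hρ.nonneg _ _)⟩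
  obtain ⟨h, hh, hlt⟩ := hex _ hpos hk
  exact hlt.not_ge (hmin ⟨hlt.le.trans hk, hh⟩)

/-- A continuous pseudo-metric `ρ` with compact balls is dominated by a continuous pseudo-metric
that controls the effect of the groupoid operations on `ρ`. -/
theorem IsTopological.exists_pseudoMetric_controlling (hS : S.IsTopological) [SigmaCompactSpace G]
    (hsource : IsOpenMap S.source) (hρ : IsContinuousPseudoMetric ρ)
    (hcpt : ∀ g r, IsCompact {h | ρ g h ≤ r}) :
    ∃ σ : G → G → ℝ, IsContinuousPseudoMetric σ ∧ (∀ g h, ρ g h ≤ σ g h) ∧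
      (∀ g h, σ g h = 0 → ρ (S.src g) (S.src h) = 0) ∧
      (∀ g h, σ g h = 0 → ρ (S.tgt g) (S.tgt h) = 0) ∧
      (∀ g h, σ g h = 0 → ρ (S.inv g) (S.inv h) = 0) ∧
      (∀ g g' h h' (w : S.src g = S.tgt h) (w' : S.src g' = S.tgt h'), σ g g' = 0 → σ h h' = 0 →
        ρ (S.mul g h w) (S.mul g' h' w') = 0) ∧
      ∀ g y, S.src y = y → σ (S.src g) y = 0 → ∃ g', S.src g' = y ∧ ρ g g' = 0 := by
  obtain ⟨μ, hμ, hμ'⟩ := hS.exists_pseudoMetric_mul hρ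
  obtain ⟨τ, hτ, hτ'⟩ := hS.exists_pseudoMetric_lift hsource hρ hcpt
  have hs := hρ.comp hS.continuous_src
  have ht := hρ.comp hS.continuous_tgt
  have hi := hρ.comp hS.continuous_inv
  have key : ∀ {g h}, ρ g h + ρ (S.src g) (S.src h) + ρ (S.tgt g) (S.tgt h) +
      ρ (S.inv g) (S.inv h) + μ g h + τ g h = 0 → ρ (S.src g) (S.src h) = 0 ∧
      ρ (S.tgt g) (S.tgt h) = 0 ∧ ρ (S.inv g) (S.inv h) = 0 ∧ μ g h = 0 ∧ τ g h = 0 := by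
    intro g h h₀
    have h₁ := hρ.nonneg g h
    have h₂ := hs.nonneg g h
    have h₃ := ht.nonneg g h
    have h₄ := hi.nonneg g h
    have h₅ := hμ.nonneg g h
    have h₆ := hτ.nonneg g h
    refine ⟨?_, ?_, ?_, ?_, ?_⟩ <;> linarith
  refine ⟨_, ((((hρ.add hs).add ht).add hi).add hμ).add hτ, fun g h => ?_,
    fun g h h₀ => (key h₀).1, fun g h h₀ => (key h₀).2.1, fun g h h₀ => (key h₀).2.2.1,
    fun g g' h h' w w' h₀ h₁ => hμ' g g' h h' w w' (key h₀).2.2.2.1 (key h₁).2.2.2.1,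
    fun g y hy h₀ => hτ' g y hy (key h₀).2.2.2.2⟩
  linarith [hs.nonneg g h, ht.nonneg g h, hi.nonneg g h, hμ.nonneg g h, hτ.nonneg g h]

end GroupoidStructure

/-! ### Iteration to a compatible pseudo-metric -/

namespace GroupoidStructure

variable {G : Type u} {S : GroupoidStructure G} [TopologicalSpace G] {ρ : G → G → ℝ}

/-- A continuous pseudo-metric `ρ` with compact balls is dominated by a continuous pseudo-metric
whose zero relation is compatible with the groupoid operations. -/
theorem IsTopological.exists_pseudoMetric_compatible (hS : S.IsTopological) [SigmaCompactSpace G]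
    (hsource : IsOpenMap S.source) (hρ : IsContinuousPseudoMetric ρ)
    (hcpt : ∀ g r, IsCompact {h | ρ g h ≤ r}) :
    ∃ δ : G → G → ℝ, IsContinuousPseudoMetric δ ∧ (∀ g h, ρ g h ≤ δ g h) ∧
      (∀ g h, δ g h = 0 → δ (S.src g) (S.src h) = 0) ∧
      (∀ g h, δ g h = 0 → δ (S.tgt g) (S.tgt h) = 0) ∧
      (∀ g h, δ g h = 0 → δ (S.inv g) (S.inv h) = 0) ∧
      (∀ g g' h h' (w : S.src g = S.tgt h) (w' : S.src g' = S.tgt h'), δ g g' = 0 → δ h h' = 0 →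
        δ (S.mul g h w) (S.mul g' h' w') = 0) ∧
      ∀ g y, S.src y = y → δ (S.src g) y = 0 → ∃ g', S.src g' = y ∧ δ g g' = 0 := by
  have := hS.hausdorff
  have := hS.locallyCompact
  have hcpt' : ∀ σ : G → G → ℝ, IsContinuousPseudoMetric σ → (∀ g h, ρ g h ≤ σ g h) →
      ∀ g r, IsCompact {h | σ g h ≤ r} := fun σ hσ hle g r =>
    (hcpt g r).of_isClosed_subset (isClosed_le (hσ.continuous_right g) continuous_const)
      fun h hh => (hle g h).trans hh
  have hstep : ∀ τ : {σ : G → G → ℝ // IsContinuousPseudoMetric σ ∧ ∀ g h, ρ g h ≤ σ g h},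
      ∃ σ : {σ : G → G → ℝ // IsContinuousPseudoMetric σ ∧ ∀ g h, ρ g h ≤ σ g h},
        (∀ g h, τ.1 g h ≤ σ.1 g h) ∧
        (∀ g h, σ.1 g h = 0 → τ.1 (S.src g) (S.src h) = 0) ∧
        (∀ g h, σ.1 g h = 0 → τ.1 (S.tgt g) (S.tgt h) = 0) ∧
        (∀ g h, σ.1 g h = 0 → τ.1 (S.inv g) (S.inv h) = 0) ∧
        (∀ g g' h h' (w : S.src g = S.tgt h) (w' : S.src g' = S.tgt h'), σ.1 g g' = 0 →
          σ.1 h h' = 0 → τ.1 (S.mul g h w) (S.mul g' h' w') = 0) ∧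
        ∀ g y, S.src y = y → σ.1 (S.src g) y = 0 → ∃ g', S.src g' = y ∧ τ.1 g g' = 0 := by
    rintro ⟨τ, hτ, hle⟩
    obtain ⟨σ, hσ, hle', h⟩ :=
      hS.exists_pseudoMetric_controlling hsource hτ (hcpt' τ hτ hle)
    exact ⟨⟨σ, hσ, fun g h => (hle g h).trans (hle' g h)⟩, hle', h⟩
  choose step hmono hsrc htgt hinv hmul hlift using hstep
  let R : ℕ → {σ : G → G → ℝ // IsContinuousPseudoMetric σ ∧ ∀ g h, ρ g h ≤ σ g h} :=
    fun k => step^[k] ⟨ρ, hρ, fun _ _ => le_rfl⟩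
  have hR : ∀ k, R (k + 1) = step (R k) := fun k => iterate_succ_apply' _ _ _
  have hRmono : ∀ g h, Monotone fun k => (R k).1 g h := fun g h =>
    monotone_nat_of_le_succ fun k => by rw [hR]; exact hmono _ _ _
  obtain ⟨σ, hσ, hσ₀⟩ := exists_isContinuousPseudoMetric_of_family
    (fun (z : ℕ × G) x => (R z.1).1 z.2 x) (by
      have h : Continuous fun q : ℕ × (G × G) => (R q.1).1 q.2.1 q.2.2 :=
        continuous_prod_of_discrete_left.2 fun k => (R k).2.1.continuous
      exact h.comp ((continuous_fst.comp continuous_snd).prodMk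
        ((continuous_snd.comp continuous_snd).prodMk continuous_fst)))
  have hzero : ∀ g h, ρ g h + σ g h = 0 ↔ ∀ k, (R k).1 g h = 0 := by
    intro g h
    constructor
    · intro h₀ k
      -- Evaluate the family at the parameter `(k, g)`, where it takes the value zero on `g`.
      rw [← (hσ₀ g h).1 (hρ.eq_zero_of_add hσ h₀).2 (k, g), (R k).2.1.self]
    · intro h₀
      have h₁ : ρ g h = 0 := h₀ 0
      rw [h₁, (hσ₀ g h).2 fun z => (R z.1).2.1.eq_right_of_eq_zero (h₀ z.1) z.2, add_zero]
  refine ⟨fun g h => ρ g h + σ g h, hρ.add hσ, fun g h => le_add_of_nonneg_right (hσ.nonneg g h),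
    ?_⟩
  simp only [hzero]
  refine ⟨fun g h h₀ k => hsrc _ _ _ (hR k ▸ h₀ (k + 1)),
    fun g h h₀ k => htgt _ _ _ (hR k ▸ h₀ (k + 1)), fun g h h₀ k => hinv _ _ _ (hR k ▸ h₀ (k + 1)),
    fun g g' h h' w w' h₀ h₁ k =>
      hmul _ _ _ _ _ w w' (hR k ▸ h₀ (k + 1)) (hR k ▸ h₁ (k + 1)), fun g y hy h₀ => ?_⟩
  have hclosed : ∀ k, IsClosed {g' | S.src g' = y ∧ (R k).1 g g' ≤ 0} := fun k =>
    (isClosed_eq hS.continuous_src continuous_const).inter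
      (isClosed_le ((R k).2.1.continuous_right g) continuous_const)
  -- Each stage supplies its own lift; the sets of lifts are compact and decreasing, so one lift
  -- serves all stages.
  obtain ⟨g', hg'⟩ := IsCompact.nonempty_iInter_of_sequence_nonempty_isCompact_isClosed
    (fun k => {g' | S.src g' = y ∧ (R k).1 g g' ≤ 0})
    (fun k g' hg' => ⟨hg'.1, (hRmono g g' k.le_succ).trans hg'.2⟩)
    (fun k => by
      obtain ⟨g', hg', h₁⟩ := hlift (R k) g y hy (hR k ▸ h₀ (k + 1))
      exact ⟨g', hg', h₁.le⟩)
    ((hcpt g 0).of_isClosed_subset (hclosed 0) fun g' hg' => hg'.2) hclosed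
  rw [mem_iInter] at hg'
  exact ⟨g', (hg' 0).1, fun k => le_antisymm (hg' k).2 ((R k).2.1.nonneg _ _)⟩

end GroupoidStructure

/-! ### The metric quotient and the main theorem -/

theorem toMetricQuotient_eq_iff {X : Type u} (d : PseudoMetricSpace X) {x y : X} :
    toMetricQuotient d x = toMetricQuotient d y ↔ d.dist x y = 0 :=
  SeparationQuotient.mk_eq_mk.trans (Metric.inseparable_iff (α := WithPseudoMetric d))

theorem toMetricQuotient_surjective {X : Type u} (d : PseudoMetricSpace X) :
    Function.Surjective (toMetricQuotient d) :=
  SeparationQuotient.surjective_mk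

theorem isProper_metricQuotientMap {X : Type u} (d : PseudoMetricSpace X) :
    IsProper (metricQuotientMap d) := fun K _ hK => by
  have h : IsInducing (metricQuotientMap d) := SeparationQuotient.isInducing_mk
  have hs : Surjective (metricQuotientMap d) := SeparationQuotient.surjective_mk
  rw [h.isCompact_iff, image_preimage_eq _ hs]
  exact hK

/-- Compact sets are bounded, so the preimage is a closed subset of a compact ball. -/
theorem isProper_toPseudoMetric {X : Type u} [TopologicalSpace X] (d : PseudoMetricSpace X)
    (hc : Continuous (toPseudoMetric d)) (hd : ∀ x r, IsCompact {y | d.dist x y ≤ r}) :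
    IsProper (toPseudoMetric d) := fun K hK hK' => by
  rcases isEmpty_or_nonempty X with hX | ⟨⟨x⟩⟩
  · rw [Set.eq_empty_of_isEmpty (toPseudoMetric d ⁻¹' K)]
    exact isCompact_empty
  · obtain ⟨r, hr⟩ := hK'.isBounded.subset_closedBall (toPseudoMetric d x)
    refine (hd x r).of_isClosed_subset (hK.preimage hc) fun y hy => ?_
    exact (d.dist_comm x y).trans_le (hr hy)

theorem mainTheorem5 {G : Type u} [TopologicalSpace G] (S : GroupoidStructure G)
    (hS : S.IsTopological) (hσ : SigmaCompactSpace G)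
    (hsource : IsOpenMap S.source) (htarget : IsOpenMap S.target)
    (𝒲₀ : ℕ → Set (Set S.units)) (𝒲₁ : ℕ → Set (Set G))
    (h𝒲₀ : IsNormalOpenSequence 𝒲₀) (h𝒲₁ : IsNormalOpenSequence 𝒲₁) :
    ∃ (d : PseudoMetricSpace G) (T : GroupoidStructure (MetricQuotient d)),
      -- the quotient is a second countable, locally compact, Hausdorff topological groupoid
      T.IsTopological ∧ SecondCountableTopology (MetricQuotient d) ∧
      -- its groupoid structure is induced by that of `G`
      IsGroupoidMorphism S T (toMetricQuotient d) ∧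
      -- both maps of the chain are proper and continuous
      Continuous (toPseudoMetric d) ∧ IsProper (toPseudoMetric d) ∧
      Continuous (metricQuotientMap d) ∧ IsProper (metricQuotientMap d) ∧
      -- preimages of balls of radius `2⁻ⁿ`, in the arrow space and in the object space
      ∀ n : ℕ,
        Refines {V : Set G | ∃ y : MetricQuotient d,
          V = toMetricQuotient d ⁻¹' Metric.ball y ((1 / 2 : ℝ) ^ n)} (𝒲₁ n) ∧
        Refines {V : Set S.units | ∃ y ∈ T.units,
          V = (fun x : S.units => toMetricQuotient d (x : G)) ⁻¹'
            Metric.ball y ((1 / 2 : ℝ) ^ n)} (𝒲₀ n) := by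
  have := hS.hausdorff
  have := hS.locallyCompact
  obtain ⟨ρ₀, hρ₀, hball₀⟩ := h𝒲₀.exists_isContinuousPseudoMetric
  obtain ⟨ρ₁, hρ₁, hball₁⟩ := h𝒲₁.exists_isContinuousPseudoMetric
  obtain ⟨φ, hφ⟩ := exists_continuous_isCompact_sublevel G
  have hs := hρ₀.comp hS.continuous_source
  have hφ' := IsContinuousPseudoMetric.of_dist φ.continuous
  have hρ := (hs.add hρ₁).add hφ'
  have hcpt : ∀ g r, IsCompact
      {h | ρ₀ (S.source g) (S.source h) + ρ₁ g h + dist (φ g) (φ h) ≤ r} := fun g r => by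
    refine (hφ (φ g + r)).of_isClosed_subset
      (isClosed_le (hρ.continuous_right g) continuous_const) fun h hh => ?_
    have h₁ := hs.nonneg g h
    have h₂ := hρ₁.nonneg g h
    have h₃ := abs_le.1 (Real.dist_eq (φ g) (φ h)).ge
    rw [mem_ofPred_eq] at hh ⊢
    linarith
  obtain ⟨δ, hδ, hle, hsrc, htgt, hinv, hmul, hlift⟩ :=
    hS.exists_pseudoMetric_compatible hsource hρ hcpt
  let d : PseudoMetricSpace G :=
    { dist := δ
      dist_self := hδ.self
      dist_comm := hδ.comm
      dist_triangle := hδ.triangle }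
  have heq : ∀ {g h}, toMetricQuotient d g = toMetricQuotient d h ↔ δ g h = 0 :=
    toMetricQuotient_eq_iff d
  have hp : S.Descends (toMetricQuotient d) :=
    { surjective := toMetricQuotient_surjective d
      src := fun h => heq.2 (hsrc _ _ (heq.1 h))
      tgt := fun h => heq.2 (htgt _ _ (heq.1 h))
      inv := fun h => heq.2 (hinv _ _ (heq.1 h))
      mul := fun w w' h h' => heq.2 (hmul _ _ _ _ w w' (heq.1 h) (heq.1 h'))
      lift := fun g y hy h => by
        obtain ⟨g', hg', h'⟩ := hlift g y hy (heq.1 h)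
        exact ⟨g', hg', (heq.2 h').symm⟩ }
  have hc : Continuous (toPseudoMetric d) := by
    refine continuous_iff_continuousAt.2 fun g => tendsto_iff_dist_tendsto_zero.2 ?_
    have h := (hδ.continuous_right g).tendsto g
    rw [hδ.self] at h
    exact h.congr fun k => hδ.comm g k
  have hδcpt : ∀ g r, IsCompact {h | δ g h ≤ r} := fun g r =>
    (hcpt g r).of_isClosed_subset (isClosed_le (hδ.continuous_right g) continuous_const)
      fun h hh => (hle g h).trans hh
  have hproper := isProper_toPseudoMetric d hc hδcpt
  have hqc : Continuous (metricQuotientMap d) := SeparationQuotient.continuous_mk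
  have hpm : IsProperMap (toMetricQuotient d) :=
    isProperMap_iff_isCompact_preimage.2 ⟨hqc.comp hc, fun K hK =>
      hproper _ (hK.isClosed.preimage hqc) (isProper_metricQuotientMap d K hK.isClosed hK)⟩
  have : SigmaCompactSpace (MetricQuotient d) := by
    rw [← isSigmaCompact_univ_iff, ← (toMetricQuotient_surjective d).range_eq]
    exact isSigmaCompact_range hpm.continuous
  refine ⟨d, hp.quotient, hp.isTopological_quotient hS hpm,
    EMetric.secondCountable_of_sigmaCompact _, hp.isGroupoidMorphism, hc, hproper, hqc,
    isProper_metricQuotientMap d, fun n => ⟨?_, ?_⟩⟩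
  · rintro _ ⟨y, rfl⟩
    obtain ⟨g, rfl⟩ := toMetricQuotient_surjective d y
    obtain ⟨V, hV, hgV⟩ := hball₁ n g
    refine ⟨V, hV, fun h hh => hgV ?_⟩
    have hh' : δ h g < (1 / 2 : ℝ) ^ n := hh
    rw [hδ.comm] at hh'
    exact (by linarith [hle g h, hs.nonneg g h, hφ'.nonneg g h] : ρ₁ g h ≤ δ g h).trans_lt hh'
  · rintro _ ⟨y, hy, rfl⟩
    obtain ⟨g, rfl⟩ := toMetricQuotient_surjective d y
    obtain ⟨V, hV, hgV⟩ := hball₀ n (S.source g)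
    refine ⟨V, hV, fun x hx => hgV ?_⟩
    -- A unit of the quotient may be represented by a non-identity arrow `g`; it is also the class
    -- of `S.src g`, which serves as the centre.
    have hy' : toMetricQuotient d (S.src g) = toMetricQuotient d g :=
      (hp.descend_src g).symm.trans hy
    have hx' : toMetricQuotient d x ∈ Metric.ball (toMetricQuotient d g) ((1 / 2 : ℝ) ^ n) := hx
    rw [← hy'] at hx'
    have hx'' : δ x (S.src g) < (1 / 2 : ℝ) ^ n := hx'
    rw [hδ.comm] at hx''
    have h₁ : S.source (S.src g) = S.source g := Subtype.ext (S.src_src g)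
    have h₂ : S.source x = x := Subtype.ext x.2
    have h₃ := hle (S.src g) x
    rw [h₁, h₂] at h₃
    exact (by linarith [hρ₁.nonneg (S.src g) x, hφ'.nonneg (S.src g) x] :
      ρ₀ (S.source g) x ≤ δ (S.src g) x).trans_lt hx''
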